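/- Let $n,p$ be integers with $1\le p\le n-1$. Let $\mathbf C\langle x\rangle$ be the field of rational functions over $\mathbf C$ in the countably many independent variables $x_i^{(r)}$ ($1\le i\le n$, $r\ge 0$, $x_i^{(0)}=x_i$), equipped with the $\mathbf C$-linear derivation $d$ determined by $d\,x_i^{(r)}=x_i^{(r+1)}$, and put $x^{(r)}=(x_1^{(r)},\dots,x_n^{(r)})^T$. A matrix $g\in GL(n,\mathbf C)$ acts on $\varphi\in\mathbf C\langle x\rangle$ by $\varphi(x)\mapsto\varphi(gx)$, that is, by substituting $\sum_{j} g_{ij}x_j^{(r)}$ for every $x_i^{(r)}$; for a subgroup $G\subset GL(n,\mathbf C)$ let $\mathbf C\langle x\rangle^{G}$ be the differential field of all $\varphi\in\mathbf C\langle x\rangle$ with $\varphi(gx)=\varphi(x)$ for all $g\in G$. Let $$[u,v]=u_1v_1+\dots+u_pv_p-u_{p+1}v_{p+1}-\dots-u_nv_n,$$ let $E_p$ be the diagonal matrix of this form, let $O(n,p,\mathbf C)=\{g\in GL(n,\mathbf C): g^TE_pg=E_p\}$ and $SO(n,p,\mathbf C)=\{g\in O(n,p,\mathbf C):\det g=1\}$,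 and let $M(x)$ be the $n\times n$ matrix with columns $x,x^{(1)},\dots,x^{(n-1)}$. Say that a set $A$ generates a differential field $F$ with $\mathbf C\subset F\subset\mathbf C\langle x\rangle$ if $F$ is the smallest subfield of $\mathbf C\langle x\rangle$ that contains $\mathbf C$ and $A$ and is closed under $d$. Then: (1) $\mathbf C\langle x\rangle^{O(n,p,\mathbf C)}$ is generated as a differential field by the polynomials $[x^{(j-1)},x^{(j-1)}]$, $j=1,\dots,n$; (2) $\mathbf C\langle x\rangle^{SO(n,p,\mathbf C)}$ is generated as a differential field by the polynomials $[x^{(j-1)},x^{(j-1)}]$, $j=1,\dots,n-1$, together with $i^{\,n-p}\det M(x)$, where $i^2=-1$. -/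

import Mathlib

open scoped Matrix

noncomputable section

namespace DInvariants

/-- The polynomial ring over `ℂ` in the variables `x_i^{(r)}`; the variable `(i, r)` stands for
the `r`-th derivative of the `i`-th coordinate. -/
abbrev DPoly (n : ℕ) : Type := MvPolynomial (Fin n × ℕ) ℂ

/-- The field `ℂ⟨x⟩` of `d`-rational functions in `x = (x_1, …, x_n)`. -/
abbrev DRat (n : ℕ) : Type := FractionRing (DPoly n)

/-- The generic vector `x^{(r)} = (x_1^{(r)}, …, x_n^{(r)})`, with entries in `ℂ⟨x⟩`. -/
def xder (n r : ℕ) : Fin n → DRat n :=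
  fun i => algebraMap (DPoly n) (DRat n) (MvPolynomial.X (i, r))

/-! ### The derivation -/

/-- The `ℂ`-derivation of the polynomial ring with `x_i^{(r)} ↦ x_i^{(r+1)}`. -/
def polyDeriv (n : ℕ) : Derivation ℂ (DPoly n) (DPoly n) :=
  MvPolynomial.mkDerivation ℂ fun v => MvPolynomial.X (v.1, v.2 + 1)

section Extension

variable {k A : Type*} (K : Type*) [Field k] [CommRing A] [IsDomain A] [Algebra k A] [Field K]
  [Algebra A K] [IsFractionRing A K] [Algebra k K] [IsScalarTower k A K]

/-- The homomorphism `q ↦ q + (D q) ε` to the dual numbers over the fraction field. -/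
def toDual (D : Derivation k A A) : A →ₐ[k] TrivSqZeroExt K K where
  toFun q := TrivSqZeroExt.inl (algebraMap A K q) + TrivSqZeroExt.inr (algebraMap A K (D q))
  map_one' := by ext <;> simp
  map_mul' a b := by
    ext
    · simp
    · simp [-DualNumber.inr_eq_smul_eps, mul_comm]
  map_zero' := by ext <;> simp
  map_add' a b := by ext <;> simp [-DualNumber.inr_eq_smul_eps]
  commutes' c := by
    ext
    · simp [TrivSqZeroExt.algebraMap_eq_inl', ← IsScalarTower.algebraMap_apply k A K]
    · simp [TrivSqZeroExt.algebraMap_eq_inl']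

theorem fst_toDual (D : Derivation k A A) (q : A) :
    (toDual K D q).fst = algebraMap A K q := by
  simp [toDual]

theorem snd_toDual (D : Derivation k A A) (q : A) :
    (toDual K D q).snd = algebraMap A K (D q) := by
  simp [toDual, -DualNumber.inr_eq_smul_eps]

theorem isUnit_toDual (D : Derivation k A A) (q : nonZeroDivisors A) :
    IsUnit (toDual K D q) := by
  rw [TrivSqZeroExt.isUnit_iff_isUnit_fst, fst_toDual, isUnit_iff_ne_zero]
  exact IsFractionRing.to_map_ne_zero_of_mem_nonZeroDivisors q.2

/-- The extension of `q ↦ q + (D q) ε` to the fraction field. -/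
def fracToDual (D : Derivation k A A) : K →ₐ[k] TrivSqZeroExt K K :=
  IsLocalization.liftAlgHom (M := nonZeroDivisors A) (f := toDual K D) (isUnit_toDual K D)

theorem fracToDual_algebraMap (D : Derivation k A A) (q : A) :
    fracToDual K D (algebraMap A K q) = toDual K D q :=
  IsLocalization.lift_eq (M := nonZeroDivisors A) (isUnit_toDual K D) q

theorem fst_fracToDual (D : Derivation k A A) (f : K) : (fracToDual K D f).fst = f := by
  have h : ((TrivSqZeroExt.fstHom k K K).comp (fracToDual K D)).toRingHom = RingHom.id K := by
    apply IsLocalization.ringHom_ext (nonZeroDivisors A)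
    ext q
    simp [fracToDual_algebraMap, fst_toDual]
  exact congrArg (fun u : K →+* K => u f) h

/-- The extension of a derivation of a domain to its fraction field (quotient rule), read off from
the homomorphism `f ↦ f + (D f) ε`. -/
def extendDerivation (D : Derivation k A A) : Derivation k K K :=
  Derivation.mk' ((TrivSqZeroExt.sndHom K K).restrictScalars k ∘ₗ (fracToDual K D).toLinearMap) (by
    intro a b
    simp [fst_fracToDual, mul_comm])

theorem extendDerivation_algebraMap (D : Derivation k A A) (q : A) :
    extendDerivation K D (algebraMap A K q) = algebraMap A K (D q) := by
  simp [extendDerivation, fracToDual_algebraMap, snd_toDual]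

end Extension

/-- The derivation `d` of `ℂ⟨x⟩`: the unique `ℂ`-derivation with `d x_i^{(r)} = x_i^{(r+1)}`. -/
def dDeriv (n : ℕ) : Derivation ℂ (DRat n) (DRat n) :=
  extendDerivation (DRat n) (polyDeriv n)

theorem dDeriv_xder (n r : ℕ) (i : Fin n) : dDeriv n (xder n r i) = xder n (r + 1) i := by
  rw [dDeriv, xder, extendDerivation_algebraMap, polyDeriv, MvPolynomial.mkDerivation_X, xder]

theorem dDeriv_unique (n : ℕ) (D : Derivation ℂ (DRat n) (DRat n))
    (h : ∀ r i, D (xder n r i) = xder n (r + 1) i) : D = dDeriv n := by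
  have hp : ∀ q : DPoly n, D (algebraMap _ _ q) = dDeriv n (algebraMap _ _ q) := by
    have := MvPolynomial.derivation_ext (D₁ := D.compAlgebraMap (DPoly n))
      (D₂ := (dDeriv n).compAlgebraMap (DPoly n)) (fun v => by
        have h1 := h v.2 v.1
        have h2 := dDeriv_xder n v.2 v.1
        exact h1.trans h2.symm)
    exact fun q => congrArg (fun u : Derivation ℂ (DPoly n) (DRat n) => u q) this
  ext f
  obtain ⟨a, b, hb, rfl⟩ := IsFractionRing.div_surjective (A := DPoly n) f
  simp [Derivation.leibniz_div, hp]

/-! ### Differential generators -/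

/-- The differential subfield of `ℂ⟨x⟩` generated by `A` (over the constants `ℂ`): the smallest
subfield that contains `ℂ` and `A` and is closed under `d`. -/
def diffAdjoin {n : ℕ} (A : Set (DRat n)) : IntermediateField ℂ (DRat n) :=
  sInf {F | A ⊆ F ∧ ∀ f ∈ F, dDeriv n f ∈ F}

/-! ### The action of the linear group and its invariants -/

/-- Substitution `q(x) ↦ q(gx)`, i.e. `x_i^{(r)} ↦ ∑ j, g_{ij} x_j^{(r)}`, on polynomials. -/
def polySubst {n : ℕ} (g : Matrix (Fin n) (Fin n) ℂ) : DPoly n →ₐ[ℂ] DPoly n :=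
  MvPolynomial.aeval fun v => ∑ j, MvPolynomial.C (g v.1 j) * MvPolynomial.X (j, v.2)

theorem polySubst_comp {n : ℕ} (g h : Matrix (Fin n) (Fin n) ℂ) :
    (polySubst g).comp (polySubst h) = polySubst (h * g) := by
  ext1 v
  simp only [polySubst, AlgHom.comp_apply, MvPolynomial.aeval_X, map_sum, map_mul,
    MvPolynomial.aeval_C, MvPolynomial.algebraMap_eq, Matrix.mul_apply, Finset.mul_sum,
    Finset.sum_mul]
  rw [Finset.sum_comm]
  simp [mul_assoc]

theorem polySubst_one (n : ℕ) :
    polySubst (1 : Matrix (Fin n) (Fin n) ℂ) = AlgHom.id ℂ (DPoly n) := by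
  ext1 v
  simp [polySubst, Matrix.one_apply]

/-- Substitution `q(x) ↦ q(gx)` on polynomials, for invertible `g`. -/
def polySubstEquiv {n : ℕ} (g : GL (Fin n) ℂ) : DPoly n ≃ₐ[ℂ] DPoly n :=
  AlgEquiv.ofAlgHom (polySubst g) (polySubst (g⁻¹ : GL (Fin n) ℂ))
    (by rw [polySubst_comp, ← Units.val_mul, inv_mul_cancel, Units.val_one, polySubst_one])
    (by rw [polySubst_comp, ← Units.val_mul, mul_inv_cancel, Units.val_one, polySubst_one])

/-- Substitution `φ(x) ↦ φ(gx)` on `d`-rational functions. -/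
def subst {n : ℕ} (g : GL (Fin n) ℂ) : DRat n ≃ₐ[ℂ] DRat n :=
  IsFractionRing.fieldEquivOfAlgEquiv ℂ (DRat n) (DRat n) (polySubstEquiv g)

theorem subst_xder {n : ℕ} (g : GL (Fin n) ℂ) (r : ℕ) (i : Fin n) :
    subst g (xder n r i) = ∑ j, algebraMap ℂ (DRat n) (g i j) * xder n r j := by
  have h : subst g (xder n r i) =
      algebraMap (DPoly n) (DRat n) (polySubst g (MvPolynomial.X (i, r))) :=
    IsFractionRing.fieldEquivOfAlgEquiv_algebraMap ℂ (DRat n) (DRat n) (polySubstEquiv g) _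
  rw [h, polySubst, MvPolynomial.aeval_X, map_sum]
  refine Finset.sum_congr rfl fun j _ => ?_
  rw [map_mul, IsScalarTower.algebraMap_apply ℂ (DPoly n) (DRat n), MvPolynomial.algebraMap_eq,
    xder]

/-- The field `ℂ⟨x⟩^G` of `G`-invariant `d`-rational functions: all `φ` with `φ(gx) = φ(x)` for
every `g ∈ G`. -/
def invariantField {n : ℕ} (G : Subgroup (GL (Fin n) ℂ)) : IntermediateField ℂ (DRat n) where
  carrier := {φ | ∀ g ∈ G, subst g φ = φ}
  mul_mem' ha hb g hg := by rw [map_mul, ha g hg, hb g hg]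
  add_mem' ha hb g hg := by rw [map_add, ha g hg, hb g hg]
  algebraMap_mem' c g _ := (subst g).commutes c
  inv_mem' a ha g hg := by rw [map_inv₀, ha g hg]

/-! ### The pseudo-orthogonal groups, the form, and the matrix `M(x)` -/

/-- The diagonal matrix `E_p`, with the first `p` diagonal entries `1` and the others `-1`. -/
def signMatrix (n p : ℕ) : Matrix (Fin n) (Fin n) ℂ :=
  Matrix.diagonal fun i => if (i : ℕ) < p then 1 else -1

/-- The group `O(n,p,ℂ)`. -/
def pseudoOrthogonal (n p : ℕ) : Subgroup (GL (Fin n) ℂ) where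
  carrier := {g | (g : Matrix (Fin n) (Fin n) ℂ)ᵀ * signMatrix n p * g = signMatrix n p}
  one_mem' := by simp
  mul_mem' {a b} ha hb := by
    simp only [Set.mem_ofPred_eq] at ha hb ⊢
    rw [Units.val_mul, Matrix.transpose_mul]
    calc _ = (b : Matrix (Fin n) (Fin n) ℂ)ᵀ *
          ((a : Matrix (Fin n) (Fin n) ℂ)ᵀ * signMatrix n p * a) * b := by
            simp only [Matrix.mul_assoc]
      _ = _ := by rw [ha, hb]
  inv_mem' {a} ha := by
    simp only [Set.mem_ofPred_eq] at ha ⊢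
    have h : (a : Matrix (Fin n) (Fin n) ℂ) * (a⁻¹ : GL (Fin n) ℂ) = 1 := by
      rw [← Units.val_mul, mul_inv_cancel, Units.val_one]
    have h' : ((a⁻¹ : GL (Fin n) ℂ) : Matrix (Fin n) (Fin n) ℂ)ᵀ *
        (a : Matrix (Fin n) (Fin n) ℂ)ᵀ = 1 := by
      rw [← Matrix.transpose_mul, h, Matrix.transpose_one]
    calc _ = ((a⁻¹ : GL (Fin n) ℂ) : Matrix (Fin n) (Fin n) ℂ)ᵀ *
          ((a : Matrix (Fin n) (Fin n) ℂ)ᵀ * signMatrix n p * a) * (a⁻¹ : GL (Fin n) ℂ) := by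
            rw [ha]
      _ = (((a⁻¹ : GL (Fin n) ℂ) : Matrix (Fin n) (Fin n) ℂ)ᵀ *
          (a : Matrix (Fin n) (Fin n) ℂ)ᵀ) * signMatrix n p *
          ((a : Matrix (Fin n) (Fin n) ℂ) * (a⁻¹ : GL (Fin n) ℂ)) := by
            simp only [Matrix.mul_assoc]
      _ = _ := by rw [h, h', Matrix.one_mul, Matrix.mul_one]

/-- The group `SO(n,p,ℂ)`. -/
def specialPseudoOrthogonal (n p : ℕ) : Subgroup (GL (Fin n) ℂ) :=
  pseudoOrthogonal n p ⊓ Matrix.GeneralLinearGroup.det.ker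

/-- The form `[u, v] = u_1 v_1 + ⋯ + u_p v_p - u_{p+1} v_{p+1} - ⋯ - u_n v_n`. -/
def bracket {n : ℕ} {R : Type*} [CommRing R] (p : ℕ) (u v : Fin n → R) : R :=
  ∑ i : Fin n, if (i : ℕ) < p then u i * v i else -(u i * v i)

/-- The matrix `M(x)` with columns `x, x^{(1)}, …, x^{(n-1)}`. -/
def wronskian (n : ℕ) : Matrix (Fin n) (Fin n) (DRat n) :=
  Matrix.of fun i j => xder n j i

end DInvariants

end

open scoped Matrix

noncomputable section

/-! Generators are invariant and `d` commutes with every substitution, which gives one inclusion.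
For the other, let `F` be the generated differential field. Differentiating squares yields mixed
products `[x^(i), x^(j)]`. The squares with `k ≥ n` come from the vanishing Gram determinants of `n
+ 1` vectors in an `n`-dimensional space. So `F` contains all the products (`gram_mem`). In the
special case the missing square comes from `det M ^ 2` (`gram_mem_of_det`). An element of `ℂ⟨x⟩`
outside `F` is separated by two `F`-embeddings `σ, τ` into some field `Ω`
(`exists_algHom_apply_ne`). Since `σ` and `τ` agree on all Gram entries, `σ x^(r) = y τ x^(r)` for a
single `y` in the orthogonal group over `Ω` (`exists_orthogonal_of_gram_eq`), with `det y = 1` if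
`det M ∈ F`. By the Nullstellensatz, invariance under the complex points of the group passes to the
`Ω`-point `y` (`apply_eq_of_mem_invariantField`), so `σ` and `τ` agree on invariants. Hence every
invariant lies in `F`. -/

namespace DInvariants

/-! ### Separating elements of a field extension by pairs of embeddings. -/

section Separating

open scoped TensorProduct
open Polynomial

variable {F K : Type*} [Field F] [Field K] [Algebra F K]

/-- The difference of the two copies of `a` vanishes in `K ⊗ K` only if `a` lies in `F`. -/
theorem mem_range_of_tmul_one_eq_one_tmul {a : K}
    (h : a ⊗ₜ[F] (1 : K) = (1 : K) ⊗ₜ[F] a) : a ∈ (algebraMap F K).range := by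
  by_contra ha
  have ha' : a ∉ Submodule.span F {(1 : K)} := by
    rw [Submodule.mem_span_singleton]
    rintro ⟨c, rfl⟩
    exact ha ⟨c, Algebra.algebraMap_eq_smul_one c⟩
  -- For a functional `f` killing `1` but not `a`, the map `id ⊗ f` sends the two sides to `0` and
  -- `f a`.
  obtain ⟨f, hfa, hf⟩ := Submodule.exists_le_ker_of_notMem ha'
  have h1 : f 1 = 0 := hf (Submodule.mem_span_singleton_self 1)
  have := congrArg (TensorProduct.rid F K ∘ LinearMap.lTensor K f) h
  simp only [Function.comp_apply, LinearMap.lTensor_tmul, TensorProduct.rid_tmul, h1,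
    zero_smul] at this
  rw [Algebra.smul_def, mul_one] at this
  exact hfa ((map_eq_zero (algebraMap F K)).mp this.symm)

/-- By flatness `F[X] ⊗ F[X]` embeds in `K ⊗ K`. It is a polynomial ring over `F[X]`, hence a
domain, and the difference corresponds to `C X - X`. -/
theorem not_isNilpotent_tmul_sub_tmul_of_transcendental {a : K} (ha : Transcendental F a) :
    ¬ IsNilpotent (a ⊗ₜ[F] (1 : K) - (1 : K) ⊗ₜ[F] a) := by
  let f : F[X] ⊗[F] F[X] →ₐ[F] K ⊗[F] K := Algebra.TensorProduct.map (aeval a) (aeval a)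
  have hinj : Function.Injective (aeval a : F[X] →ₐ[F] K) :=
    transcendental_iff_injective.mp ha
  have hf : Function.Injective f :=
    TensorProduct.map_injective_of_flat_flat (aeval a : F[X] →ₐ[F] K).toLinearMap
      (aeval a : F[X] →ₐ[F] K).toLinearMap hinj hinj
  have hδ : (f.comp (polyEquivTensor F F[X]).toAlgHom) (C X - X) =
      a ⊗ₜ[F] (1 : K) - (1 : K) ⊗ₜ[F] a := by
    simp [f]
  have hg : Function.Injective (f.comp (polyEquivTensor F F[X]).toAlgHom) :=
    hf.comp (polyEquivTensor F F[X]).injective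
  rw [← hδ, IsNilpotent.map_iff hg, isNilpotent_iff_eq_zero]
  exact fun h => X_sub_C_ne_zero (X : F[X]) (by rw [← neg_sub, h, neg_zero])

/-- Separability makes `L ⊗ L` reduced, so a nilpotent difference would be zero and `i b` would lie
in `F`. -/
theorem not_isNilpotent_tmul_sub_tmul_of_isSeparable {L : Type*} [Field L] [Algebra F L]
    [FiniteDimensional F L] [Algebra.IsSeparable F L] (i : L →ₐ[F] K) (b : L)
    (hb : i b ∉ (algebraMap F K).range) :
    ¬ IsNilpotent (i b ⊗ₜ[F] (1 : K) - (1 : K) ⊗ₜ[F] i b) := by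
  have : Algebra.FormallyUnramified F L := Algebra.FormallyUnramified.of_isSeparable F L
  have : IsReduced (L ⊗[F] L) :=
    Algebra.FormallyUnramified.isReduced_of_field L (L ⊗[F] L)
  let f : L ⊗[F] L →ₐ[F] K ⊗[F] K := Algebra.TensorProduct.map i i
  have hf : Function.Injective f :=
    TensorProduct.map_injective_of_flat_flat i.toLinearMap i.toLinearMap i.injective i.injective
  have hδ : f (b ⊗ₜ[F] (1 : L) - (1 : L) ⊗ₜ[F] b) =
      i b ⊗ₜ[F] (1 : K) - (1 : K) ⊗ₜ[F] i b := by
    simp [f]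
  rw [← hδ, IsNilpotent.map_iff hf, isNilpotent_iff_eq_zero]
  intro h
  rw [h, map_zero] at hδ
  exact hb (mem_range_of_tmul_one_eq_one_tmul (sub_eq_zero.mp hδ.symm))

/-- In characteristic zero, an element outside the base field is moved by some pair of embeddings
into a common field. -/
theorem exists_algHom_apply_ne.{v} {F : Type*} {K : Type v} [Field F] [Field K] [Algebra F K]
    [CharZero F] {a : K} (haF : a ∉ (algebraMap F K).range) :
    ∃ (Ω : Type v) (_ : Field Ω) (_ : Algebra F Ω) (σ τ : K →ₐ[F] Ω), σ a ≠ τ a := by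
  have hnil : ¬ IsNilpotent (a ⊗ₜ[F] (1 : K) - (1 : K) ⊗ₜ[F] a) := by
    by_cases ha : IsAlgebraic F a
    · have : FiniteDimensional F (IntermediateField.adjoin F {a}) :=
        IntermediateField.adjoin.finiteDimensional ha.isIntegral
      exact not_isNilpotent_tmul_sub_tmul_of_isSeparable (IntermediateField.adjoin F {a}).val
        (IntermediateField.AdjoinSimple.gen F a) haF
    · exact not_isNilpotent_tmul_sub_tmul_of_transcendental ha
  -- Some prime of `K ⊗ K` misses the difference; the two coprojections into its residue field are
  -- the embeddings.
  rw [nilpotent_iff_mem_prime] at hnil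
  push Not at hnil
  obtain ⟨P, hP, hmem⟩ := hnil
  let π : K ⊗[F] K →ₐ[F] P.ResidueField := IsScalarTower.toAlgHom F (K ⊗[F] K) P.ResidueField
  refine ⟨P.ResidueField, inferInstance, inferInstance, π.comp Algebra.TensorProduct.includeLeft,
    π.comp Algebra.TensorProduct.includeRight, fun h => hmem ?_⟩
  rw [← Ideal.algebraMap_residueField_eq_zero, map_sub, sub_eq_zero]
  exact h

end Separating

/-! ### Density of the rational points over an algebraically closed field. -/

section Density

open MvPolynomial

/-- A polynomial over an extension `Ω` of an algebraically closed field `k` that vanishes at all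
`k`-points of an affine variety defined over `k` vanishes at all its `Ω`-points. -/
theorem eval_eq_zero_of_forall_zeroLocus {k Ω s : Type*} [Field k] [IsAlgClosed k] [Field Ω]
    [Algebra k Ω] [Finite s] (I : Ideal (MvPolynomial s k)) (Φ : MvPolynomial s Ω)
    (hΦ : ∀ h ∈ zeroLocus k I, eval (fun i => algebraMap k Ω (h i)) Φ = 0)
    (y : s → Ω) (hy : ∀ f ∈ I, aeval y f = 0) : eval y Φ = 0 := by
  -- Expanding coefficients in a `k`-basis of `Ω` gives `Φ = ∑ b t * q t`. Each `q t` vanishes at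
  -- the `k`-points, so it lies in the radical of `I`.
  let b := Module.Basis.ofVectorSpace k Ω
  let q : _ → MvPolynomial s k := fun t =>
    ∑ m ∈ Φ.support, monomial m (b.repr (Φ.coeff m) t)
  have hq : ∀ t, aeval y (q t) = 0 := by
    intro t
    have hrad : q t ∈ I.radical := by
      rw [← vanishingIdeal_zeroLocus_eq_radical (K := k) I, mem_vanishingIdeal_iff]
      intro h hh
      have h0 := congrArg (fun w => b.repr w t) (hΦ h hh)
      rw [eval_eq] at h0
      simp only [map_sum, ← map_pow, ← map_prod, mul_comm _ (algebraMap k Ω _),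
        ← Algebra.smul_def, map_smul, map_zero, Finsupp.coe_finsetSum, Finset.sum_apply,
        Finsupp.smul_apply, Finsupp.zero_apply, smul_eq_mul] at h0
      rw [← h0]
      simp only [q, map_sum, aeval_monomial]
      refine Finset.sum_congr rfl fun m _ => ?_
      rw [mul_comm]
      rfl
    obtain ⟨N, hN⟩ := hrad
    have := hy _ hN
    rw [map_pow] at this
    exact eq_zero_of_pow_eq_zero this
  classical
  let T := Φ.support.biUnion fun m => (b.repr (Φ.coeff m)).support
  have hc : ∀ m ∈ Φ.support, Φ.coeff m = ∑ t ∈ T, b.repr (Φ.coeff m) t • b t := by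
    intro m hm
    conv_lhs => rw [← b.linearCombination_repr (Φ.coeff m), Finsupp.linearCombination_apply]
    refine Finsupp.sum_of_support_subset _ (fun t ht => ?_) _ (by simp)
    exact Finset.mem_biUnion.mpr ⟨m, hm, ht⟩
  calc eval y Φ = ∑ t ∈ T, b t * aeval y (q t) := by
        simp only [q, map_sum, aeval_monomial, Finset.mul_sum]
        rw [Finset.sum_comm, eval_eq]
        refine Finset.sum_congr rfl fun m hm => ?_
        conv_lhs => rw [hc m hm, Finset.sum_mul]
        refine Finset.sum_congr rfl fun t _ => ?_
        rw [Algebra.smul_def, Finsupp.prod]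
        ring
    _ = 0 := by simp [hq]

end Density

/-! ### The form and its Gram matrices. -/

section Bracket

variable {n : ℕ} {R : Type*} [CommRing R]

theorem bracket_comm (p : ℕ) (u v : Fin n → R) : bracket p u v = bracket p v u := by
  simp only [bracket, mul_comm]

theorem map_bracket {S H : Type*} [CommRing S] [FunLike H R S] [RingHomClass H R S] (f : H)
    (p : ℕ) (u v : Fin n → R) :
    f (bracket p u v) = bracket p (fun i => f (u i)) (fun i => f (v i)) := by
  simp only [bracket, map_sum, apply_ite f, map_neg, map_mul]

/-- The diagonal matrix `E_p` over a `ℂ`-algebra. -/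
def signMatrixOver (R : Type*) [CommRing R] [Algebra ℂ R] (n p : ℕ) : Matrix (Fin n) (Fin n) R :=
  (signMatrix n p).map (algebraMap ℂ R)

theorem bracket_eq_dotProduct [Algebra ℂ R] (p : ℕ) (u v : Fin n → R) :
    bracket p u v = u ⬝ᵥ (signMatrixOver R n p *ᵥ v) := by
  have h : signMatrixOver R n p =
      Matrix.diagonal fun i : Fin n => if (i : ℕ) < p then 1 else -1 := by
    rw [signMatrixOver, signMatrix, Matrix.diagonal_map (map_zero _)]
    congr 1
    ext i
    split_ifs <;> simp
  simp only [bracket, h, dotProduct, Matrix.mulVec_diagonal]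
  refine Finset.sum_congr rfl fun i _ => ?_
  split_ifs <;> ring

/-- The matrix of products of the columns of `U` with the columns of `V`. -/
theorem transpose_mul_signMatrixOver_mul [Algebra ℂ R] {ι κ : Type*} (p : ℕ)
    (U : Matrix (Fin n) ι R) (V : Matrix (Fin n) κ R) :
    Uᵀ * signMatrixOver R n p * V = Matrix.of fun i j => bracket p (U.col i) (V.col j) := by
  ext i j
  rw [Matrix.of_apply, bracket_eq_dotProduct, Matrix.mul_assoc, Matrix.mul_apply]
  rfl

end Bracket

/-! ### Generating all products `[x^(i), x^(j)]` from finitely many squares. -/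

/-- The differential polynomial `[x^{(i)}, x^{(j)}]`. -/
def gram (n p i j : ℕ) : DRat n := bracket p (xder n i) (xder n j)

theorem gram_comm (n p i j : ℕ) : gram n p i j = gram n p j i := bracket_comm _ _ _

theorem dDeriv_gram (n p i j : ℕ) :
    dDeriv n (gram n p i j) = gram n p (i + 1) j + gram n p i (j + 1) := by
  simp only [gram, bracket, map_sum, ← Finset.sum_add_distrib]
  refine Finset.sum_congr rfl fun k _ => ?_
  split_ifs <;> simp only [Derivation.leibniz, map_neg, dDeriv_xder, smul_eq_mul] <;> ring

/-- The squares `[x^{(k)}, x^{(k)}]` with `k < N` generate the products `[x^{(i)}, x^{(j)}]` with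
`i + j < 2 N`. -/
theorem gram_mem_of_lt {n p : ℕ} {F : IntermediateField ℂ (DRat n)}
    (hF : ∀ f ∈ F, dDeriv n f ∈ F) {N : ℕ} (h : ∀ k < N, gram n p k k ∈ F) :
    ∀ i j, i + j < 2 * N → gram n p i j ∈ F := by
  -- Induction on the weight `w = i + j`, then on the gap `t = j - i` in steps of two. Gap `0` is a
  -- given square, gap `1` is half the derivative of a square, and gap `t + 2` is the derivative of
  -- a product of gap `t + 1` minus a product of gap `t`.
  have key : ∀ w < 2 * N, ∀ t i, i + (i + t) = w → gram n p i (i + t) ∈ F := by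
    intro w
    induction w with
    | zero =>
      intro hw t i hi
      obtain ⟨rfl, rfl⟩ : i = 0 ∧ t = 0 := by omega
      exact h 0 (by omega)
    | succ w ih =>
      intro hw t
      induction t using Nat.twoStepInduction with
      | zero => intro i hi; exact h i (by omega)
      | one =>
        intro i hi
        have h1 := hF _ (ih (by omega) 0 i (by omega))
        rw [add_zero, dDeriv_gram, gram_comm n p (i + 1) i, ← two_mul] at h1
        have h2 : (2 : DRat n) ∈ F := ofNat_mem F 2
        have := F.mul_mem (F.inv_mem h2) h1
        rwa [inv_mul_cancel_left₀ two_ne_zero] at this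
      | more t ih1 _ =>
        intro i hi
        have h1 := hF _ (ih (by omega) (t + 1) i (by omega))
        have h2 := ih1 (i + 1) (by omega)
        rw [dDeriv_gram] at h1
        have h3 : i + 1 + t = i + (t + 1) := by ring
        rw [h3] at h2
        have := F.sub_mem h1 h2
        rwa [add_sub_cancel_left] at this
  intro i j hij
  rcases le_total i j with hle | hle
  · obtain ⟨t, rfl⟩ := Nat.exists_eq_add_of_le hle
    exact key _ hij t i rfl
  · obtain ⟨t, rfl⟩ := Nat.exists_eq_add_of_le hle
    rw [gram_comm]
    exact key _ hij t j (by omega)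

section Corner

variable {k K : Type*} [Field k] [Field K] [Algebra k K] (F : IntermediateField k K)

theorem det_mem {ι : Type*} [Fintype ι] [DecidableEq ι] {A : Matrix ι ι K}
    (hA : ∀ i j, A i j ∈ F) : A.det ∈ F := by
  rw [Matrix.det_apply']
  exact F.sum_mem fun σ _ => F.mul_mem (intCast_mem F _) (F.prod_mem fun i _ => hA _ _)

/-- The corner entry of a matrix lies in a subfield that contains the other entries and the
determinant, provided the complementary minor does not vanish. -/
theorem corner_mem {m : ℕ} {A : Matrix (Fin (m + 1)) (Fin (m + 1)) K}
    (hA : ∀ i j, i ≠ Fin.last m ∨ j ≠ Fin.last m → A i j ∈ F) (hdet : A.det ∈ F)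
    (hminor : (A.submatrix Fin.castSucc Fin.castSucc).det ≠ 0) :
    A (Fin.last m) (Fin.last m) ∈ F := by
  have hsub : (A.submatrix Fin.castSucc Fin.castSucc).det ∈ F :=
    det_mem F fun i j => hA _ _ (Or.inl (Fin.castSucc_lt_last i).ne)
  rw [Matrix.det_succ_row A (Fin.last m), Fin.sum_univ_castSucc] at hdet
  have hrest : ∑ j : Fin m, (-1) ^ ((Fin.last m : ℕ) + (j.castSucc : ℕ)) *
      A (Fin.last m) j.castSucc *
      (A.submatrix (Fin.last m).succAbove j.castSucc.succAbove).det ∈ F := by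
    refine F.sum_mem fun j _ => F.mul_mem (F.mul_mem ?_ ?_) (det_mem F fun i l => ?_)
    · exact pow_mem (neg_mem (one_mem _)) _
    · exact hA _ _ (Or.inr (Fin.castSucc_lt_last j).ne)
    · rw [Matrix.submatrix_apply, Fin.succAbove_last]
      exact hA _ _ (Or.inl (Fin.castSucc_lt_last i).ne)
  have h := F.sub_mem hdet hrest
  rw [add_sub_cancel_left, Fin.succAbove_last, ← two_mul, pow_mul, neg_one_sq, one_pow,
    one_mul] at h
  have := F.mul_mem h (F.inv_mem hsub)
  rwa [mul_inv_cancel_right₀ hminor] at this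

end Corner

/-- Specializing `x^(r)` to the `r`-th standard basis vector turns the Gram matrix into a diagonal
one with entries `±1`. -/
theorem det_gram_ne_zero {n : ℕ} (p : ℕ) {m : ℕ} (hm : m ≤ n) :
    (Matrix.of fun i j : Fin m => gram n p i j).det ≠ 0 := by
  let x : ℕ → Fin n → DPoly n := fun r i => MvPolynomial.X (i, r)
  let B : Matrix (Fin m) (Fin m) (DPoly n) := Matrix.of fun i j => bracket p (x i) (x j)
  have hB : (Matrix.of fun i j : Fin m => gram n p i j) =
      (algebraMap (DPoly n) (DRat n)).mapMatrix B := by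
    ext i j
    simp only [gram, B, Matrix.of_apply, RingHom.mapMatrix_apply, Matrix.map_apply, map_bracket]
    rfl
  let e : DPoly n →+* ℂ := MvPolynomial.eval fun v => if (v.1 : ℕ) = v.2 then 1 else 0
  have he : e B.det ≠ 0 := by
    have : e.mapMatrix B = Matrix.diagonal fun i : Fin m => if (i : ℕ) < p then 1 else -1 := by
      ext i j
      change e (bracket p (x i) (x j)) = _
      rw [map_bracket, bracket, Finset.sum_eq_single (Fin.castLE hm i)]
      · by_cases hij : i = j
        · subst hij; simp [e, x]
        · have : (i : ℕ) ≠ j := fun h => hij (Fin.ext h)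
          simp [e, x, this, hij]
      · intro b _ hb
        have : (b : ℕ) ≠ i := fun h => hb (Fin.ext h)
        simp [e, x, this]
      · simp
    rw [RingHom.map_det, this, Matrix.det_diagonal, Finset.prod_ne_zero_iff]
    intro i _
    split_ifs <;> simp
  rw [hB, ← RingHom.map_det]
  intro h
  rw [map_eq_zero_iff _ (IsFractionRing.injective (DPoly n) (DRat n))] at h
  exact he (by rw [h, map_zero])

/-- The row of indices `0, …, m - 1, k`. -/
def borderIndex (m k : ℕ) : Fin (m + 1) → ℕ := Fin.snoc (fun i : Fin m => (i : ℕ)) k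

/-- Since `m ≤ k`, every entry but the corner has index sum below `2 * k`, and the minor
complementary to the corner is a nonzero Gram determinant. -/
theorem gram_self_mem_of_det {n p m k : ℕ} (hm : m ≤ n) (hk : m ≤ k)
    {F : IntermediateField ℂ (DRat n)} (h : ∀ i j, i + j < 2 * k → gram n p i j ∈ F)
    (hdet : (Matrix.of fun i j => gram n p (borderIndex m k i) (borderIndex m k j)).det ∈ F) :
    gram n p k k ∈ F := by
  have hc := corner_mem F (m := m)
    (A := Matrix.of fun i j => gram n p (borderIndex m k i) (borderIndex m k j)) ?_ hdet ?_
  · simpa [borderIndex] using hc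
  · intro i j hij
    refine h _ _ ?_
    induction i using Fin.lastCases with
    | last =>
      induction j using Fin.lastCases with
      | last => simp at hij
      | cast j => simp only [borderIndex, Fin.snoc_last, Fin.snoc_castSucc]; omega
    | cast i =>
      induction j using Fin.lastCases with
      | last => simp only [borderIndex, Fin.snoc_last, Fin.snoc_castSucc]; omega
      | cast j => simp only [borderIndex, Fin.snoc_castSucc]; omega
  · have hsub : (Matrix.of fun i j => gram n p (borderIndex m k i) (borderIndex m k j)).submatrix
        Fin.castSucc Fin.castSucc = Matrix.of fun i j : Fin m => gram n p i j := by
      ext i j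
      simp [borderIndex]
    rw [hsub]
    exact det_gram_ne_zero p hm

/-- The matrix factors through an `n`-dimensional space, since `n + 1` vectors with `n` coordinates
are linearly dependent. -/
theorem det_gram_border_eq_zero (n p k : ℕ) :
    (Matrix.of fun i j => gram n p (borderIndex n k i) (borderIndex n k j)).det = 0 := by
  let U : Matrix (Fin n) (Fin (n + 1)) (DRat n) := Matrix.of fun i j => xder n (borderIndex n k j) i
  have hU : (Matrix.of fun i j => gram n p (borderIndex n k i) (borderIndex n k j)) =
      Uᵀ * signMatrixOver (DRat n) n p * U :=
    (transpose_mul_signMatrixOver_mul p U U).symm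
  obtain ⟨v, hv, hv0⟩ : ∃ v, v ≠ 0 ∧ U *ᵥ v = 0 := by
    have hker : LinearMap.ker (Matrix.mulVecLin U) ≠ ⊥ :=
      LinearMap.ker_ne_bot_of_finrank_lt (by simp)
    obtain ⟨v, hv, hv0⟩ := Submodule.exists_mem_ne_zero_of_ne_bot hker
    exact ⟨v, hv0, hv⟩
  rw [hU, ← Matrix.exists_mulVec_eq_zero_iff]
  exact ⟨v, hv, by rw [← Matrix.mulVec_mulVec, hv0, Matrix.mulVec_zero]⟩

theorem gram_mem {n p : ℕ} {F : IntermediateField ℂ (DRat n)}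
    (hF : ∀ f ∈ F, dDeriv n f ∈ F) (h : ∀ k < n, gram n p k k ∈ F) (i j : ℕ) :
    gram n p i j ∈ F := by
  have key : ∀ N, ∀ k < n + N, gram n p k k ∈ F := by
    intro N
    induction N with
    | zero => exact h
    | succ N ih =>
      intro k hk
      rcases Nat.lt_succ_iff_lt_or_eq.mp hk with hk | rfl
      · exact ih k hk
      · exact gram_self_mem_of_det le_rfl (Nat.le_add_right n N) (gram_mem_of_lt hF ih)
          (by rw [det_gram_border_eq_zero]; exact F.zero_mem)
  exact gram_mem_of_lt hF (key (i + j + 1)) i j (by omega)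

theorem transpose_wronskian_mul (n p : ℕ) :
    (wronskian n)ᵀ * signMatrixOver (DRat n) n p * wronskian n =
      Matrix.of fun i j : Fin n => gram n p i j :=
  transpose_mul_signMatrixOver_mul p _ _

theorem det_wronskian_ne_zero (n : ℕ) : (wronskian n).det ≠ 0 := by
  -- The signature is irrelevant here; `0` is an arbitrary choice.
  have h := det_gram_ne_zero (n := n) 0 le_rfl
  rw [← transpose_wronskian_mul, Matrix.det_mul] at h
  exact right_ne_zero_of_mul h

/-- The last square `[x^{(n-1)}, x^{(n-1)}]` is obtained from the other ones and the determinant. -/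
theorem gram_mem_of_det {n p : ℕ} {F : IntermediateField ℂ (DRat n)}
    (hF : ∀ f ∈ F, dDeriv n f ∈ F) (h : ∀ k < n - 1, gram n p k k ∈ F)
    (hdet : (wronskian n).det ∈ F) (i j : ℕ) : gram n p i j ∈ F := by
  refine gram_mem hF (fun k hk => ?_) i j
  rcases Nat.lt_or_ge k (n - 1) with hk' | hk'
  · exact h k hk'
  obtain ⟨m, rfl⟩ : ∃ m, n = m + 1 := ⟨n - 1, by omega⟩
  obtain rfl : k = m := by omega
  refine gram_self_mem_of_det (Nat.le_succ k) le_rfl (gram_mem_of_lt hF h) ?_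
  -- With `m = k = n - 1` the bordered matrix is the full Gram matrix `Mᵀ E M`, whose determinant is
  -- `det M ^ 2 * det E`.
  have hb : (Matrix.of fun i j => gram (k + 1) p (borderIndex k k i) (borderIndex k k j)) =
      Matrix.of fun i j : Fin (k + 1) => gram (k + 1) p i j := by
    have : ∀ i : Fin (k + 1), borderIndex k k i = i := by
      intro i
      induction i using Fin.lastCases <;> simp [borderIndex]
    simp only [this]
  rw [hb, ← transpose_wronskian_mul, Matrix.det_mul, Matrix.det_mul, Matrix.det_transpose]
  refine F.mul_mem (F.mul_mem hdet ?_) hdet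
  exact det_mem F fun i j => F.algebraMap_mem _

/-! ### Equations of the pseudo-orthogonal groups. -/

section Relations

open MvPolynomial

variable {n : ℕ}

theorem signMatrixOver_map {R S : Type*} [CommRing R] [Algebra ℂ R] [CommRing S] [Algebra ℂ S]
    (f : R →ₐ[ℂ] S) (n p : ℕ) : (signMatrixOver R n p).map f = signMatrixOver S n p := by
  ext i j
  simp [signMatrixOver]

theorem signMatrixOver_complex (n p : ℕ) : signMatrixOver ℂ n p = signMatrix n p := by
  ext i j
  simp [signMatrixOver]

theorem det_signMatrix_ne_zero (n p : ℕ) : (signMatrix n p).det ≠ 0 := by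
  rw [signMatrix, Matrix.det_diagonal, Finset.prod_ne_zero_iff]
  intro i _
  split_ifs <;> simp

/-- The matrix whose entries are the equations of the pseudo-orthogonal group. -/
def orthogonalRelation (n p : ℕ) :
    Matrix (Fin n) (Fin n) (MvPolynomial (Fin n × Fin n) ℂ) :=
  (Matrix.mvPolynomialX (Fin n) (Fin n) ℂ)ᵀ * signMatrixOver _ n p *
    Matrix.mvPolynomialX (Fin n) (Fin n) ℂ - signMatrixOver _ n p

/-- The ideal of equations of the pseudo-orthogonal group. -/
def orthogonalIdeal (n p : ℕ) : Ideal (MvPolynomial (Fin n × Fin n) ℂ) :=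
  Ideal.span (Set.range fun v : Fin n × Fin n => orthogonalRelation n p v.1 v.2)

/-- The ideal of equations of the special pseudo-orthogonal group. -/
def specialOrthogonalIdeal (n p : ℕ) : Ideal (MvPolynomial (Fin n × Fin n) ℂ) :=
  orthogonalIdeal n p ⊔ Ideal.span {(Matrix.mvPolynomialX (Fin n) (Fin n) ℂ).det - 1}

variable {R : Type*} [CommRing R] [Algebra ℂ R]

theorem mapMatrix_orthogonalRelation (p : ℕ) (y : Matrix (Fin n) (Fin n) R) :
    (aeval fun v : Fin n × Fin n => y v.1 v.2).mapMatrix (orthogonalRelation n p) =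
      yᵀ * signMatrixOver R n p * y - signMatrixOver R n p := by
  have hX : (aeval fun v : Fin n × Fin n => y v.1 v.2).mapMatrix
      (Matrix.mvPolynomialX (Fin n) (Fin n) ℂ) = y := Matrix.mvPolynomialX_mapMatrix_aeval ℂ y
  have hXt : (aeval fun v : Fin n × Fin n => y v.1 v.2).mapMatrix
      (Matrix.mvPolynomialX (Fin n) (Fin n) ℂ)ᵀ = yᵀ := by
    exact congrArg Matrix.transpose hX
  have hE : (aeval fun v : Fin n × Fin n => y v.1 v.2).mapMatrix
      (signMatrixOver (MvPolynomial (Fin n × Fin n) ℂ) n p) = signMatrixOver R n p :=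
    signMatrixOver_map _ n p
  rw [orthogonalRelation, map_sub, map_mul, map_mul, hX, hXt, hE]

/-- The ring `R` is left general so that the equations can be read both over `ℂ` and over `Ω`. -/
theorem forall_orthogonalIdeal_iff (p : ℕ) (y : Matrix (Fin n) (Fin n) R) :
    (∀ f ∈ orthogonalIdeal n p, aeval (fun v : Fin n × Fin n => y v.1 v.2) f = 0) ↔
      yᵀ * signMatrixOver R n p * y = signMatrixOver R n p := by
  have h1 : (∀ f ∈ orthogonalIdeal n p, aeval (fun v : Fin n × Fin n => y v.1 v.2) f = 0) ↔
      orthogonalIdeal n p ≤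
        RingHom.ker (aeval (R := ℂ) fun v : Fin n × Fin n => y v.1 v.2) := Iff.rfl
  rw [h1, orthogonalIdeal, Ideal.span_le, Set.range_subset_iff, ← sub_eq_zero,
    ← mapMatrix_orthogonalRelation, ← Matrix.ext_iff, Prod.forall]
  rfl

theorem forall_specialOrthogonalIdeal_iff (p : ℕ) (y : Matrix (Fin n) (Fin n) R) :
    (∀ f ∈ specialOrthogonalIdeal n p, aeval (fun v : Fin n × Fin n => y v.1 v.2) f = 0) ↔
      yᵀ * signMatrixOver R n p * y = signMatrixOver R n p ∧ y.det = 1 := by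
  have h1 : (∀ f ∈ specialOrthogonalIdeal n p,
        aeval (fun v : Fin n × Fin n => y v.1 v.2) f = 0) ↔
      specialOrthogonalIdeal n p ≤
        RingHom.ker (aeval (R := ℂ) fun v : Fin n × Fin n => y v.1 v.2) := Iff.rfl
  have hX : (aeval fun v : Fin n × Fin n => y v.1 v.2).mapMatrix
      (Matrix.mvPolynomialX (Fin n) (Fin n) ℂ) = y := Matrix.mvPolynomialX_mapMatrix_aeval ℂ y
  rw [h1, specialOrthogonalIdeal, sup_le_iff, Ideal.span_le, Set.singleton_subset_iff,
    ← forall_orthogonalIdeal_iff]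
  refine and_congr Iff.rfl ?_
  rw [SetLike.mem_coe, RingHom.mem_ker, map_sub, map_one, AlgHom.map_det, hX, sub_eq_zero]

theorem exists_mem_pseudoOrthogonal {p : ℕ} {y : Matrix (Fin n) (Fin n) ℂ}
    (hy : yᵀ * signMatrixOver ℂ n p * y = signMatrixOver ℂ n p) :
    ∃ g ∈ pseudoOrthogonal n p, (g : Matrix (Fin n) (Fin n) ℂ) = y := by
  rw [signMatrixOver_complex] at hy
  have hdet : y.det ≠ 0 := by
    intro h0
    have := congrArg Matrix.det hy
    rw [Matrix.det_mul, h0, mul_zero] at this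
    exact det_signMatrix_ne_zero n p this.symm
  exact ⟨Matrix.GeneralLinearGroup.mkOfDetNeZero y hdet, hy, rfl⟩

end Relations

/-! ### Comparing two specializations of the generic vector. -/

section Specialization

open MvPolynomial

variable {n : ℕ} {Ω : Type*} [Field Ω] [Algebra ℂ Ω]

/-- If a group `G` is given by polynomial equations and `y` is an `Ω`-point of it, then two
specializations of `x` that differ by `y` agree on the `G`-invariants. -/
theorem apply_eq_of_mem_invariantField {G : Subgroup (GL (Fin n) ℂ)}
    (I : Ideal (MvPolynomial (Fin n × Fin n) ℂ))
    (hI : ∀ h : Matrix (Fin n) (Fin n) ℂ,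
      (∀ f ∈ I, aeval (fun v : Fin n × Fin n => h v.1 v.2) f = 0) →
        ∃ g ∈ G, (g : Matrix (Fin n) (Fin n) ℂ) = h)
    {σ τ : DRat n →ₐ[ℂ] Ω} {y : Matrix (Fin n) (Fin n) Ω}
    (hy : ∀ f ∈ I, aeval (fun v : Fin n × Fin n => y v.1 v.2) f = 0)
    (hστ : ∀ r i, σ (xder n r i) = ∑ j, y i j * τ (xder n r j))
    {φ : DRat n} (hφ : φ ∈ invariantField G) : σ φ = τ φ := by
  obtain ⟨P, Q, hQ, rfl⟩ := IsFractionRing.div_surjective (A := DPoly n) φ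
  have hQ0 : algebraMap (DPoly n) (DRat n) Q ≠ 0 :=
    IsFractionRing.to_map_ne_zero_of_mem_nonZeroDivisors hQ
  -- `S` substitutes a generic matrix times `τ x^(r)` for `x^(r)`. Evaluating that matrix at `y`
  -- recovers `σ`, and at `g` it gives `τ` after `subst g`.
  let S : DPoly n →ₐ[ℂ] MvPolynomial (Fin n × Fin n) Ω :=
    aeval fun v => ∑ j, X (v.1, j) * C (τ (xder n v.2 j))
  let ι : DPoly n →ₐ[ℂ] DRat n := IsScalarTower.toAlgHom ℂ (DPoly n) (DRat n)
  have hSy : ∀ A : DPoly n, eval (fun v => y v.1 v.2) (S A) = σ (ι A) := by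
    have : ((aeval fun v : Fin n × Fin n => y v.1 v.2).restrictScalars ℂ).comp S =
        σ.comp ι := by
      ext v
      have := hστ v.2 v.1
      simpa [S, ι, xder] using this.symm
    intro A
    exact congrArg (fun u : DPoly n →ₐ[ℂ] Ω => u A) this
  have hSh : ∀ (g : GL (Fin n) ℂ) (A : DPoly n),
      eval (fun v => algebraMap ℂ Ω (g v.1 v.2)) (S A) = τ (subst g (ι A)) := by
    intro g A
    have : ((aeval fun v : Fin n × Fin n => algebraMap ℂ Ω (g v.1 v.2)).restrictScalars ℂ).comp S =
        (τ.comp (subst g : DRat n →ₐ[ℂ] DRat n)).comp ι := by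
      ext v
      have := congrArg τ (subst_xder g v.2 v.1)
      simp only [map_sum, map_mul, AlgHom.commutes] at this
      simpa [S, ι, xder] using this.symm
    exact congrArg (fun u : DPoly n →ₐ[ℂ] Ω => u A) this
  -- With denominators cleared, invariance says that this polynomial vanishes at every complex point
  -- of the group.
  have key := eval_eq_zero_of_forall_zeroLocus I (S P * C (τ (ι Q)) - C (τ (ι P)) * S Q) ?_
    (fun v => y v.1 v.2) hy
  · rw [map_sub, map_mul, map_mul, eval_C, eval_C, hSy, hSy, sub_eq_zero] at key
    rw [map_div₀, map_div₀, div_eq_div_iff ((map_ne_zero σ).mpr hQ0) ((map_ne_zero τ).mpr hQ0)]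
    exact key
  · intro h hh
    obtain ⟨g, hg, hgh⟩ := hI (Matrix.of fun i j => h (i, j)) hh
    have hh' : h = fun v : Fin n × Fin n => g v.1 v.2 := by
      ext v
      rw [hgh]
      rfl
    have hinv := hφ g hg
    rw [map_div₀, div_eq_div_iff ((map_ne_zero (subst g)).mpr hQ0) hQ0] at hinv
    rw [hh', map_sub, map_mul, map_mul, eval_C, eval_C, hSh, hSh, ← map_mul, ← map_mul,
      sub_eq_zero]
    exact congrArg τ hinv

/-- Two specializations of `x` that agree on all `[x^{(i)}, x^{(j)}]` differ by a pseudo-orthogonal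
matrix. -/
theorem exists_orthogonal_of_gram_eq {p : ℕ} {σ τ : DRat n →ₐ[ℂ] Ω}
    (h : ∀ i j, σ (gram n p i j) = τ (gram n p i j)) :
    ∃ y : Matrix (Fin n) (Fin n) Ω, yᵀ * signMatrixOver Ω n p * y = signMatrixOver Ω n p ∧
      (wronskian n).map σ = y * (wronskian n).map τ ∧
      ∀ r i, σ (xder n r i) = ∑ j, y i j * τ (xder n r j) := by
  set E := signMatrixOver Ω n p with hE
  set A := (wronskian n).map σ with hA
  set B := (wronskian n).map τ with hB
  have hBdet : B.det ≠ 0 := by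
    have : B.det = τ (wronskian n).det := (AlgHom.map_det τ _).symm
    rw [this]
    exact (map_ne_zero τ).mpr (det_wronskian_ne_zero n)
  have hBu : IsUnit B.det := hBdet.isUnit
  have hcol : ∀ r, Aᵀ *ᵥ (E *ᵥ fun i => σ (xder n r i)) = Bᵀ *ᵥ (E *ᵥ fun i => τ (xder n r i)) := by
    intro r
    ext j
    have := h j r
    rw [gram, map_bracket, map_bracket, bracket_eq_dotProduct, bracket_eq_dotProduct] at this
    exact this
  have hAB : Aᵀ * E * A = Bᵀ * E * B := by
    ext i j
    have := congrFun (hcol j) i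
    rw [Matrix.mulVec_mulVec, Matrix.mulVec_mulVec] at this
    exact this
  have hAEdet : (Aᵀ * E).det ≠ 0 := by
    have hgram : Aᵀ * E * A = (Matrix.of fun i j : Fin n => gram n p i j).map σ := by
      rw [hE, transpose_mul_signMatrixOver_mul]
      ext i j
      exact (map_bracket σ p (xder n i) (xder n j)).symm
    have hne : (Aᵀ * E * A).det ≠ 0 := by
      rw [hgram]
      have : ((Matrix.of fun i j : Fin n => gram n p i j).map σ).det =
          σ (Matrix.of fun i j : Fin n => gram n p i j).det := (AlgHom.map_det σ _).symm
      rw [this]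
      exact (map_ne_zero σ).mpr (det_gram_ne_zero p le_rfl)
    rw [Matrix.det_mul] at hne
    exact left_ne_zero_of_mul hne
  have hyB : A = A * B⁻¹ * B := by
    rw [Matrix.mul_assoc, Matrix.nonsing_inv_mul _ hBu, Matrix.mul_one]
  have horth : (A * B⁻¹)ᵀ * E * (A * B⁻¹) = E := by
    have h1 : (A * B⁻¹)ᵀ * E * (A * B⁻¹) = (B⁻¹)ᵀ * (Aᵀ * E * A) * B⁻¹ := by
      rw [Matrix.transpose_mul]; simp only [Matrix.mul_assoc]
    rw [h1, hAB]
    calc (B⁻¹)ᵀ * (Bᵀ * E * B) * B⁻¹ = (B * B⁻¹)ᵀ * E * (B * B⁻¹) := by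
          rw [Matrix.transpose_mul]; simp only [Matrix.mul_assoc]
      _ = E := by rw [Matrix.mul_nonsing_inv _ hBu, Matrix.transpose_one, Matrix.one_mul,
          Matrix.mul_one]
  -- The first `n` derivatives force `y = A * B⁻¹`.
  refine ⟨A * B⁻¹, horth, hyB, fun r i => ?_⟩
  have hAt : Aᵀ = Bᵀ * (A * B⁻¹)ᵀ := by rw [← Matrix.transpose_mul, ← hyB]
  -- For every `r`, `σ x^(r)` and `y τ x^(r)` have the same products with the columns of `A`,
  -- because `Aᵀ E y = Bᵀ yᵀ E y = Bᵀ E`. As `Aᵀ E` is invertible, they coincide.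
  have hzero : (Aᵀ * E) *ᵥ ((fun i => σ (xder n r i)) - (A * B⁻¹) *ᵥ fun i => τ (xder n r i)) = 0 := by
    rw [Matrix.mulVec_sub, sub_eq_zero, ← Matrix.mulVec_mulVec, hcol, Matrix.mulVec_mulVec,
      Matrix.mulVec_mulVec]
    congr 1
    conv_lhs => rw [← horth]
    conv_rhs => rw [hAt]
    simp only [Matrix.mul_assoc]
  have := congrFun (Matrix.eq_zero_of_mulVec_eq_zero hAEdet hzero) i
  rw [Pi.sub_apply, Pi.zero_apply, sub_eq_zero] at this
  exact this

end Specialization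

/-! ### Invariants lie in any field containing the Gram entries (and `det M` in the special case).
-/

/-- An element on which any two embeddings that agree on `F` agree lies in `F`. -/
theorem mem_of_forall_algHom_eq.{v} {k : Type*} {K : Type v} [Field k] [CharZero k] [Field K]
    [Algebra k K] (F : IntermediateField k K) {φ : K}
    (h : ∀ (Ω : Type v) [Field Ω] [Algebra k Ω] (σ τ : K →ₐ[k] Ω),
      (∀ f ∈ F, σ f = τ f) → σ φ = τ φ) : φ ∈ F := by
  by_contra hφ
  have hφ' : φ ∉ (algebraMap F K).range := fun ⟨f, hf⟩ => hφ (hf ▸ f.2)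
  obtain ⟨Ω, _, _, σ, τ, hne⟩ := exists_algHom_apply_ne hφ'
  let _ : Algebra k Ω := ((algebraMap F Ω).comp (algebraMap k F)).toAlgebra
  have : IsScalarTower k F Ω := IsScalarTower.of_algebraMap_eq' rfl
  refine hne (h Ω (σ.restrictScalars k) (τ.restrictScalars k) fun f hf => ?_)
  exact (σ.commutes ⟨f, hf⟩).trans (τ.commutes ⟨f, hf⟩).symm

theorem invariantField_pseudoOrthogonal_le {n p : ℕ} {F : IntermediateField ℂ (DRat n)}
    (hF : ∀ i j, gram n p i j ∈ F) : invariantField (pseudoOrthogonal n p) ≤ F := by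
  intro φ hφ
  refine mem_of_forall_algHom_eq F fun Ω _ _ σ τ hστ => ?_
  obtain ⟨y, hy, -, hxy⟩ := exists_orthogonal_of_gram_eq fun i j => hστ _ (hF i j)
  exact apply_eq_of_mem_invariantField (orthogonalIdeal n p)
    (fun h hh => exists_mem_pseudoOrthogonal ((forall_orthogonalIdeal_iff p h).mp hh))
    ((forall_orthogonalIdeal_iff p y).mpr hy) hxy hφ

theorem invariantField_specialPseudoOrthogonal_le {n p : ℕ} {F : IntermediateField ℂ (DRat n)}
    (hF : ∀ i j, gram n p i j ∈ F) (hdet : (wronskian n).det ∈ F) :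
    invariantField (specialPseudoOrthogonal n p) ≤ F := by
  intro φ hφ
  refine mem_of_forall_algHom_eq F fun Ω _ _ σ τ hστ => ?_
  obtain ⟨y, hy, hw, hxy⟩ := exists_orthogonal_of_gram_eq fun i j => hστ _ (hF i j)
  -- `σ` and `τ` agree on `det M`, and `τ (det M)` is nonzero.
  have hy1 : y.det = 1 := by
    have h1 : ((wronskian n).map σ).det = σ (wronskian n).det := (AlgHom.map_det σ _).symm
    have h2 : ((wronskian n).map τ).det = τ (wronskian n).det := (AlgHom.map_det τ _).symm
    have h3 : τ (wronskian n).det ≠ 0 := (map_ne_zero τ).mpr (det_wronskian_ne_zero n)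
    rw [hw, Matrix.det_mul, h2, hστ _ hdet] at h1
    exact mul_right_cancel₀ h3 (h1.trans (one_mul _).symm)
  refine apply_eq_of_mem_invariantField (specialOrthogonalIdeal n p) (fun h hh => ?_)
    ((forall_specialOrthogonalIdeal_iff p y).mpr ⟨hy, hy1⟩) hxy hφ
  obtain ⟨hh1, hh2⟩ := (forall_specialOrthogonalIdeal_iff p h).mp hh
  obtain ⟨g, hg, rfl⟩ := exists_mem_pseudoOrthogonal hh1
  exact ⟨g, ⟨hg, Units.ext hh2⟩, rfl⟩

/-! ### Invariance of the generators and of the differential field they generate. -/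

section DiffAdjoin

variable {n : ℕ}

theorem subset_diffAdjoin (A : Set (DRat n)) : A ⊆ diffAdjoin A := by
  intro a ha
  rw [diffAdjoin, SetLike.mem_coe, IntermediateField.mem_sInf]
  exact fun F hF => hF.1 ha

theorem dDeriv_mem_diffAdjoin (A : Set (DRat n)) :
    ∀ f ∈ diffAdjoin A, dDeriv n f ∈ diffAdjoin A := by
  intro f hf
  rw [diffAdjoin, IntermediateField.mem_sInf] at hf ⊢
  exact fun F hF => hF.2 f (hf F hF)

/-- The conjugate of `d` by `subst g` is a derivation with the same values on the variables, because
`g` has constant entries; uniqueness of `d` applies. -/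
theorem dDeriv_subst (g : GL (Fin n) ℂ) (f : DRat n) :
    dDeriv n (subst g f) = subst g (dDeriv n f) := by
  let D : Derivation ℂ (DRat n) (DRat n) :=
    Derivation.mk' ((subst g).symm.toLinearMap ∘ₗ (dDeriv n : DRat n →ₗ[ℂ] DRat n) ∘ₗ
      (subst g).toLinearMap) (by
        intro a b
        simp)
  have hD : D = dDeriv n := by
    refine dDeriv_unique n D fun r i => ?_
    change (subst g).symm (dDeriv n (subst g (xder n r i))) = _
    rw [AlgEquiv.symm_apply_eq, subst_xder, subst_xder, map_sum]
    refine Finset.sum_congr rfl fun j _ => ?_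
    rw [← Algebra.smul_def, ← Algebra.smul_def, Derivation.map_smul, dDeriv_xder]
  have : D f = dDeriv n f := by rw [hD]
  rw [← this]
  exact ((subst g).apply_symm_apply _).symm

theorem diffAdjoin_le_invariantField {G : Subgroup (GL (Fin n) ℂ)} {A : Set (DRat n)}
    (hA : A ⊆ invariantField G) : diffAdjoin A ≤ invariantField G :=
  sInf_le ⟨hA, fun f hf g hg => by rw [← dDeriv_subst, hf g hg]⟩

theorem subst_xder_eq_mulVec (g : GL (Fin n) ℂ) (r : ℕ) :
    (fun i => subst g (xder n r i)) =
      (g : Matrix (Fin n) (Fin n) ℂ).map (algebraMap ℂ (DRat n)) *ᵥ xder n r := by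
  ext i
  rw [subst_xder]
  rfl

theorem gram_mem_invariantField (p i j : ℕ) :
    gram n p i j ∈ invariantField (pseudoOrthogonal n p) := by
  intro g hg
  have hg' : ((g : Matrix (Fin n) (Fin n) ℂ).map (algebraMap ℂ (DRat n)))ᵀ *
      signMatrixOver (DRat n) n p * (g : Matrix (Fin n) (Fin n) ℂ).map (algebraMap ℂ (DRat n)) =
      signMatrixOver (DRat n) n p := by
    have := congrArg (fun N => N.map (algebraMap ℂ (DRat n))) hg
    simp only [Matrix.map_mul, Matrix.transpose_map] at this
    exact this
  rw [gram, map_bracket, subst_xder_eq_mulVec, subst_xder_eq_mulVec, bracket_eq_dotProduct,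
    bracket_eq_dotProduct, ← Matrix.vecMul_transpose, ← Matrix.dotProduct_mulVec,
    Matrix.mulVec_mulVec, Matrix.mulVec_mulVec, hg']

theorem subst_det_wronskian (g : GL (Fin n) ℂ) :
    subst g (wronskian n).det =
      algebraMap ℂ (DRat n) (g : Matrix (Fin n) (Fin n) ℂ).det * (wronskian n).det := by
  have h : (subst g).mapMatrix (wronskian n) =
      (g : Matrix (Fin n) (Fin n) ℂ).map (algebraMap ℂ (DRat n)) * wronskian n := by
    ext i j
    exact congrFun (subst_xder_eq_mulVec g j) i
  rw [AlgEquiv.map_det, h, Matrix.det_mul]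
  congr 1
  exact (RingHom.map_det (algebraMap ℂ (DRat n)) _).symm

end DiffAdjoin

end DInvariants

end

theorem theorem2p4 (n p : ℕ) (hp : 1 ≤ p) (hpn : p < n) :
    DInvariants.diffAdjoin
        (Set.range fun j : Fin n =>
          DInvariants.bracket p (DInvariants.xder n j) (DInvariants.xder n j)) =
      DInvariants.invariantField (DInvariants.pseudoOrthogonal n p) ∧
    DInvariants.diffAdjoin
        ((Set.range fun j : Fin (n - 1) =>
            DInvariants.bracket p (DInvariants.xder n j) (DInvariants.xder n j)) ∪
          {algebraMap ℂ (DInvariants.DRat n) (Complex.I ^ (n - p)) *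
            (DInvariants.wronskian n).det}) =
      DInvariants.invariantField (DInvariants.specialPseudoOrthogonal n p) := by
  constructor
  · apply le_antisymm
    · apply DInvariants.diffAdjoin_le_invariantField
      rintro _ ⟨j, rfl⟩
      exact DInvariants.gram_mem_invariantField p j j
    · apply DInvariants.invariantField_pseudoOrthogonal_le
      exact DInvariants.gram_mem (DInvariants.dDeriv_mem_diffAdjoin _) fun k hk =>
        DInvariants.subset_diffAdjoin _ ⟨⟨k, hk⟩, rfl⟩
  · apply le_antisymm
    · apply DInvariants.diffAdjoin_le_invariantField
      rintro _ (⟨j, rfl⟩ | rfl)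
      · exact fun g hg => DInvariants.gram_mem_invariantField p j j g hg.1
      · intro g hg
        have hdet : (g : Matrix (Fin n) (Fin n) ℂ).det = 1 := congrArg Units.val hg.2
        rw [map_mul, AlgEquiv.commutes, DInvariants.subst_det_wronskian, hdet, map_one, one_mul]
    · set F := DInvariants.diffAdjoin
        ((Set.range fun j : Fin (n - 1) =>
            DInvariants.bracket p (DInvariants.xder n j) (DInvariants.xder n j)) ∪
          {algebraMap ℂ (DInvariants.DRat n) (Complex.I ^ (n - p)) *
            (DInvariants.wronskian n).det})
      have hdet : (DInvariants.wronskian n).det ∈ F := by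
        -- The factor `I ^ (n - p)` is a nonzero constant, so it does not affect the generated
        -- field.
        have h1 := F.mul_mem (F.algebraMap_mem (Complex.I ^ (n - p))⁻¹)
          (DInvariants.subset_diffAdjoin _ (Or.inr rfl))
        rwa [← mul_assoc, ← map_mul, inv_mul_cancel₀ (pow_ne_zero _ Complex.I_ne_zero), map_one,
          one_mul] at h1
      refine DInvariants.invariantField_specialPseudoOrthogonal_le (fun i j => ?_) hdet
      exact DInvariants.gram_mem_of_det (DInvariants.dDeriv_mem_diffAdjoin _)
        (fun k hk => DInvariants.subset_diffAdjoin _ (Or.inl ⟨⟨k, hk⟩, rfl⟩)) hdet i j
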